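/- Let $n\ge 1$ and $k\ge 2$ be integers, and let $S$ be a Steiner bundle in $\mathcal S_{n,k}$, that is, a vector bundle $S$ on the complex projective space $\mathbf P^n$ whose dual $S^*$ appears in an exact sequence $$0\to S^*\to W\otimes\mathcal O\xrightarrow{\,f_A\,} I\otimes\mathcal O(1)\to 0,$$ where $W$ and $I$ are complex vector spaces of dimension $n+k$ and $k$ respectively. A hyperplane $H\subset\mathbf P^n$ is called unstable for $S$ if $h^0(S^*|_H)\neq 0$; the unstable hyperplanes are the closed points of the scheme $W(S)\subset\mathbf P^{n\vee}$. Then any set $\mathcal H$ (finite or infinite) of distinct unstable hyperplanes of $S$ has normal crossing: for every point $p\in\mathbf P^n$, the linear forms defining those hyperplanes of $\mathcal H$ that pass through $p$ are linearly independent. (Equivalently, any $m\le n+1$ distinct hyperplanes of $\mathcal H$ have linearly independent equations.) -/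

import Mathlib

open scoped LinearAlgebra.Projectivization

/-- The complex projective space `ℙⁿ` (its closed points, i.e. the lines in `ℂⁿ⁺¹`). -/
abbrev ProjSp (n : ℕ) : Type := ℙ ℂ (Fin (n + 1) → ℂ)

/-- The dual projective space: its points are the hyperplanes of `ℙⁿ`, a hyperplane being a
nonzero linear form up to a nonzero scalar. -/
abbrev Hyperplane (n : ℕ) : Type := ℙ ℂ (Module.Dual ℂ (Fin (n + 1) → ℂ))

/-- The set of points of `ℙⁿ` lying on the hyperplane `H`. -/
def Hyperplane.points {n : ℕ} (H : Hyperplane n) : Set (ProjSp n) :=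
  {p | ∀ ξ ∈ H.submodule, ∀ x ∈ p.submodule, ξ x = 0}

/-- Regular functions on a (locally closed) subset `Z` of `ℙⁿ`: near each point of `Z` the function
is a quotient `F / G` of two homogeneous polynomials of the same degree, `G` being nonzero at that
point. (The value of such a quotient does not depend on the representative of the point.) -/
def IsRegularFun {n : ℕ} (Z : Set (ProjSp n)) (f : Z → ℂ) : Prop :=
  ∀ p : Z, ∃ (d : ℕ) (F G : MvPolynomial (Fin (n + 1)) ℂ),
    F.IsHomogeneous d ∧ G.IsHomogeneous d ∧ MvPolynomial.eval p.1.rep G ≠ 0 ∧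
      ∀ q : Z, MvPolynomial.eval q.1.rep G ≠ 0 →
        f q = MvPolynomial.eval q.1.rep F / MvPolynomial.eval q.1.rep G

/-- Regular maps from `Z` to a finite-dimensional complex vector space `W`, that is, the sections
over `Z` of the trivial bundle `W ⊗ 𝒪`: all the coordinates are regular functions. -/
def IsRegularMap {n : ℕ} {W : Type*} [AddCommGroup W] [Module ℂ W]
    (Z : Set (ProjSp n)) (s : Z → W) : Prop :=
  ∀ φ : Module.Dual ℂ W, IsRegularFun Z (fun p => φ (s p))

theorem IsRegularFun.zero {n : ℕ} (Z : Set (ProjSp n)) : IsRegularFun Z (fun _ => 0) :=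
  fun _ => ⟨0, 0, 1, MvPolynomial.isHomogeneous_zero _ _ _, MvPolynomial.isHomogeneous_one _ _,
    by simp, fun _ _ => by simp⟩

theorem IsRegularFun.add {n : ℕ} {Z : Set (ProjSp n)} {f g : Z → ℂ}
    (hf : IsRegularFun Z f) (hg : IsRegularFun Z g) : IsRegularFun Z (fun p => f p + g p) := by
  intro p
  obtain ⟨d, F, G, hF, hG, h0, h⟩ := hf p
  obtain ⟨e, F', G', hF', hG', h0', h'⟩ := hg p
  refine ⟨d + e, F * G' + G * F', G * G', (hF.mul hG').add (hG.mul hF'), hG.mul hG', ?_, ?_⟩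
  · rw [map_mul]
    exact mul_ne_zero h0 h0'
  · intro q hq
    rw [map_mul] at hq
    have h1 := left_ne_zero_of_mul hq
    have h2 := right_ne_zero_of_mul hq
    change f q + g q = _
    rw [h q h1, h' q h2, map_add, map_mul, map_mul, map_mul, div_add_div _ _ h1 h2]

theorem IsRegularFun.const_mul {n : ℕ} {Z : Set (ProjSp n)} {f : Z → ℂ} (c : ℂ)
    (hf : IsRegularFun Z f) : IsRegularFun Z (fun p => c * f p) := by
  intro p
  obtain ⟨d, F, G, hF, hG, h0, h⟩ := hf p
  refine ⟨d, MvPolynomial.C c * F, G, ?_, hG, h0, ?_⟩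
  · simpa using (MvPolynomial.isHomogeneous_C _ c).mul hF
  · intro q hq
    change c * f q = _
    rw [h q hq, map_mul, MvPolynomial.eval_C, mul_div_assoc]

/-- A Steiner bundle `S` on `ℙⁿ` in the family `𝒮_{n,k}`, given by the exact sequence
`0 → S* → W ⊗ 𝒪 → I ⊗ 𝒪(1) → 0` with `dim W = n + k` and `dim I = k`.

A morphism `W ⊗ 𝒪 → I ⊗ 𝒪(1)` is an element of `Hom(W, I ⊗ V)`, where `V = H⁰(𝒪(1))` is the space of
linear forms on `ℂⁿ⁺¹`; equivalently, a linear map `A` from `ℂⁿ⁺¹` to `Hom(W, I)`, and `A x` is the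
map induced on the fibres at the point `[x]`. The morphism is surjective when it is
surjective on the fibre at every point; then its kernel is a vector bundle of rank `n`, and
`S` is the dual of this kernel. -/
structure SteinerBundle (n k : ℕ) (W I : Type*) [AddCommGroup W] [Module ℂ W]
    [FiniteDimensional ℂ W] [AddCommGroup I] [Module ℂ I] [FiniteDimensional ℂ I] where
  A : (Fin (n + 1) → ℂ) →ₗ[ℂ] (W →ₗ[ℂ] I)
  finrank_W : Module.finrank ℂ W = n + k
  finrank_I : Module.finrank ℂ I = k
  surjective : ∀ x : Fin (n + 1) → ℂ, x ≠ 0 → Function.Surjective (A x)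

namespace SteinerBundle

variable {n k : ℕ} {W I : Type*} [AddCommGroup W] [Module ℂ W] [FiniteDimensional ℂ W]
  [AddCommGroup I] [Module ℂ I] [FiniteDimensional ℂ I]

/-- The fibre of `S*` at the point `p`: the kernel of `W → I ⊗ 𝒪(1)_p`, as a subspace of `W`. -/
def dualFiber (S : SteinerBundle n k W I) (p : ProjSp n) : Submodule ℂ W where
  carrier := {w | ∀ x ∈ p.submodule, S.A x w = 0}
  zero_mem' := fun _ _ => map_zero _
  add_mem' := fun {a b} ha hb x hx => by rw [map_add, ha x hx, hb x hx, add_zero]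
  smul_mem' := fun c a ha x hx => by rw [map_smul, ha x hx, smul_zero]

/-- The space `H⁰(Z, S*|_Z)` of regular sections over `Z` of the subbundle `S*` of `W ⊗ 𝒪`. -/
def dualSections (S : SteinerBundle n k W I) (Z : Set (ProjSp n)) : Submodule ℂ (Z → W) where
  carrier := {s | IsRegularMap Z s ∧ ∀ p : Z, s p ∈ S.dualFiber p.1}
  zero_mem' := ⟨fun φ => by simpa using IsRegularFun.zero Z, fun _ => zero_mem _⟩
  add_mem' := fun {s t} hs ht =>
    ⟨fun φ => by simpa using (hs.1 φ).add (ht.1 φ), fun p => add_mem (hs.2 p) (ht.2 p)⟩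
  smul_mem' := fun c s hs =>
    ⟨fun φ => by simpa using (hs.1 φ).const_mul c, fun p => Submodule.smul_mem _ c (hs.2 p)⟩

/-- `H` is an unstable hyperplane of `S` if `h⁰(S*|_H) ≠ 0`. -/
def IsUnstable (S : SteinerBundle n k W I) (H : Hyperplane n) : Prop :=
  Module.rank ℂ (S.dualSections H.points) ≠ 0

/-- The set of closed points of `W(S)`, i.e. of all unstable hyperplanes of `S`. -/
def unstableHyperplanes (S : SteinerBundle n k W I) : Set (Hyperplane n) :=
  {H | S.IsUnstable H}

end SteinerBundle

/-- A (possibly infinite) set of hyperplanes of `ℙⁿ` has normal crossing: at every point `p`, the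
hyperplanes of the set that pass through `p` have linearly independent equations (so that these
equations are part of a system of local parameters at `p`). -/
def HasNormalCrossing {n : ℕ} (𝓗 : Set (Hyperplane n)) : Prop :=
  ∀ p : ProjSp n,
    Projectivization.Independent (fun H : {H : Hyperplane n // H ∈ 𝓗 ∧ p ∈ H.points} => H.1)

/-!
An unstable hyperplane `ξ = 0` of a Steiner bundle `S` carries a nonzero section of `S*`. It is a map
from the hyperplane to `W`, and it is constant: a regular function restricted to a line is an entire
function with a limit at infinity, so that Liouville's theorem applies
(`IsRegularFun.eq_of_hyperplane`). Unstable hyperplanes therefore correspond to elements `w ≠ 0` of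
`W` which the tensor `A` sends to a decomposable tensor `ξ ⊗ i`
(`SteinerBundle.IsUnstable.exists_eq_smul`).

The dimension of `W` is the least one for which `A` can be surjective at every point of `ℙⁿ`. This is
Hopf's lemma, `finrank_add_finrank_le_of_bilin_ne_zero`: a bilinear map `V × U → X` without
nontrivial zeros satisfies `dim X ≥ dim V + dim U - 1`. It is Krull's height theorem at the vertex of
the Segre cone. Applied to subspaces, it bounds the dimension of any `W₀ ⊆ W` with
`A(V₀) W₀ ⊆ I₀` (`SteinerBundle.finrank_add_finrank_le`). Three instances are used: `S*` has no
nonzero global section, so `i ≠ 0` above; independent elements of `W` are not sent to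
`ξ ⊗ i` and `ξ' ⊗ i` with the same `i`, as `k ≥ 2`; and if `m` hyperplanes have a common point,
then elements of `W` sent to zero on their intersection span a space of dimension at most `m`.

Suppose now that `ξ_m = ∑ c_j ξ_j` with `j` in a set `T` of indices whose `ξ_j` are independent, all
the hyperplanes passing through one point. The last instance gives a nontrivial relation
`∑ b_j w_j = 0` over `T ∪ {m}`. Its image under `A` says that `b_j i_j + b_m c_j i_m = 0` for all
`j ∈ T`, so `b_m ≠ 0`, and `i_j` is a multiple of `i_m` for some `j`. By the second instance `w_j`
and `w_m` are proportional, hence so are `ξ_j` and `ξ_m`: the two hyperplanes coincide.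
-/

/-! ### Hopf's lemma on nondegenerate bilinear maps -/

section Segre

variable (K : Type*) [Field K] (a b : ℕ)

/-- The Segre parametrization `z i j ↦ x i * u j`, as a map of polynomial rings; the variables
`x i` and `u j` are `X (Sum.inl i)` and `X (Sum.inr j)`. -/
noncomputable def segreMap :
    MvPolynomial (Fin a × Fin b) K →ₐ[K] MvPolynomial (Fin a ⊕ Fin b) K :=
  MvPolynomial.aeval fun q => MvPolynomial.X (Sum.inl q.1) * MvPolynomial.X (Sum.inr q.2)

/-- The homogeneous coordinate ring of the Segre variety `ℙᵃ⁻¹ × ℙᵇ⁻¹`, realized as the ring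
generated by the products `x i * u j`. -/
noncomputable abbrev SegreRing : Subalgebra K (MvPolynomial (Fin a ⊕ Fin b) K) :=
  (segreMap K a b).range

/-- The endomorphism of `K[x, u]` that keeps `x i` for `i < t` and `u j` for `j ≤ t - a` and kills
the other variables. With the truncated subtraction, the variables `x 0, …, x (a - 1)` are released
one at a time as `t` grows to `a`, while among the `u j` only `u 0` is alive; the other `u j` follow
one at a time. -/
noncomputable def killVars (t : ℕ) :
    MvPolynomial (Fin a ⊕ Fin b) K →ₐ[K] MvPolynomial (Fin a ⊕ Fin b) K :=
  MvPolynomial.aeval (Sum.elim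
    (fun i : Fin a => if (i : ℕ) < t then MvPolynomial.X (Sum.inl i) else 0)
    (fun j : Fin b => if (j : ℕ) ≤ t - a then MvPolynomial.X (Sum.inr j) else 0))

/-- The prime ideal of the cone over a product of coordinate subspaces inside the Segre cone. -/
noncomputable def segrePrime (t : ℕ) : Ideal (SegreRing K a b) :=
  RingHom.ker ((killVars K a b t).comp (SegreRing K a b).val)

instance (t : ℕ) : (segrePrime K a b t).IsPrime := RingHom.ker_isPrime _

instance : IsNoetherianRing (SegreRing K a b) :=
  isNoetherianRing_of_surjective _ _ (segreMap K a b).rangeRestrict.toRingHom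
    (segreMap K a b).rangeRestrict_surjective

variable {K a b}

theorem killVars_killVars {s t : ℕ} (h : s ≤ t) (f : MvPolynomial (Fin a ⊕ Fin b) K) :
    killVars K a b s (killVars K a b t f) = killVars K a b s f := by
  rw [← AlgHom.comp_apply]
  congr 1
  apply MvPolynomial.algHom_ext
  rintro (i | j)
  · by_cases h1 : (i : ℕ) < t
    · simp [killVars, h1]
    · have h2 : ¬ (i : ℕ) < s := by omega
      simp [killVars, h1, h2]
  · by_cases h1 : (j : ℕ) ≤ t - a
    · simp [killVars, h1]
    · have h2 : ¬ (j : ℕ) ≤ s - a := by omega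
      simp [killVars, h1, h2]

theorem mem_segrePrime {t : ℕ} {f : SegreRing K a b} :
    f ∈ segrePrime K a b t ↔ killVars K a b t f = 0 := Iff.rfl

theorem rangeRestrict_mem_segrePrime {t : ℕ} {f : MvPolynomial (Fin a × Fin b) K} :
    (segreMap K a b).rangeRestrict f ∈ segrePrime K a b t ↔
      killVars K a b t (segreMap K a b f) = 0 := Iff.rfl

theorem segrePrime_antitone : Antitone (segrePrime K a b) := by
  intro s t h f hf
  rw [mem_segrePrime] at hf ⊢
  rw [← killVars_killVars h, hf, map_zero]

theorem killVars_segreMap_X (t : ℕ) (i : Fin a) (j : Fin b) :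
    killVars K a b t (segreMap K a b (MvPolynomial.X (i, j))) =
      if (i : ℕ) < t ∧ (j : ℕ) ≤ t - a then
        MvPolynomial.X (Sum.inl i) * MvPolynomial.X (Sum.inr j) else 0 := by
  by_cases h1 : (i : ℕ) < t <;> by_cases h2 : (j : ℕ) ≤ t - a <;>
    simp [killVars, segreMap, h1, h2]

theorem segrePrime_succ_lt (ha : 0 < a) (hb : 0 < b) {t : ℕ} (ht : t + 1 < a + b) :
    segrePrime K a b (t + 1) < segrePrime K a b t := by
  refine lt_of_le_not_ge (segrePrime_antitone t.le_succ) fun hle => ?_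
  -- a product of variables that is alive at stage `t + 1` but not at stage `t`
  obtain ⟨i, j, h1, h2⟩ : ∃ (i : Fin a) (j : Fin b),
      ¬ ((i : ℕ) < t ∧ (j : ℕ) ≤ t - a) ∧ ((i : ℕ) < t + 1 ∧ (j : ℕ) ≤ t + 1 - a) := by
    by_cases hta : t < a
    · exact ⟨⟨t, hta⟩, ⟨0, by omega⟩, by simp, by simp⟩
    · exact ⟨⟨0, ha⟩, ⟨t + 1 - a, by omega⟩, by simp only [not_and]; omega, by simp⟩
  have h3 : (segreMap K a b).rangeRestrict (MvPolynomial.X (i, j)) ∈ segrePrime K a b t := by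
    rw [rangeRestrict_mem_segrePrime, killVars_segreMap_X, if_neg h1]
  have h4 := hle h3
  rw [rangeRestrict_mem_segrePrime, killVars_segreMap_X, if_pos h2] at h4
  exact mul_ne_zero (MvPolynomial.X_ne_zero _) (MvPolynomial.X_ne_zero _) h4

theorem le_height_segrePrime (ha : 0 < a) (hb : 0 < b) (d : ℕ) :
    ∀ t, t + d < a + b → (d : ℕ∞) ≤ (segrePrime K a b t).height := by
  induction d with
  | zero => simp
  | succ d ih =>
    intro t ht
    have h1 := ih (t + 1) (by omega)
    have h2 := Ideal.height_add_one_le_of_lt_of_isPrime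
      (segrePrime_succ_lt (K := K) ha hb (show t + 1 < a + b by omega))
    push_cast
    exact (add_le_add_left h1 1).trans h2

theorem rangeRestrict_X_mem_segrePrime_zero (q : Fin a × Fin b) :
    (segreMap K a b).rangeRestrict (MvPolynomial.X q) ∈ segrePrime K a b 0 := by
  rw [rangeRestrict_mem_segrePrime, ← Prod.mk.eta (p := q), killVars_segreMap_X, if_neg (by simp)]

/-- Modulo the generators `x i * u j`, every element of the Segre ring is a constant. -/
theorem exists_rangeRestrict_sub_C_mem {P : Ideal (SegreRing K a b)}
    (hP : ∀ q, (segreMap K a b).rangeRestrict (MvPolynomial.X q) ∈ P)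
    (f : MvPolynomial (Fin a × Fin b) K) :
    (segreMap K a b).rangeRestrict (f - MvPolynomial.C (MvPolynomial.constantCoeff f)) ∈ P := by
  induction f using MvPolynomial.induction_on with
  | C c => simp
  | add f g hf hg =>
    have := P.add_mem hf hg
    rw [← map_add] at this
    convert this using 2
    rw [map_add, map_add]
    ring
  | mul_X f q _ =>
    rw [map_mul, MvPolynomial.constantCoeff_X, mul_zero, map_zero, sub_zero, map_mul]
    exact P.mul_mem_left _ (hP q)

/-- `segrePrime K a b 0` is the ideal of the vertex of the Segre cone: it is generated by the
products `x i * u j`. -/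
theorem segrePrime_zero_le {P : Ideal (SegreRing K a b)}
    (hP : ∀ q, (segreMap K a b).rangeRestrict (MvPolynomial.X q) ∈ P) :
    segrePrime K a b 0 ≤ P := by
  intro g hg
  obtain ⟨f, rfl⟩ := (segreMap K a b).rangeRestrict_surjective g
  have h0 := (segrePrime K a b 0).sub_mem hg
    (exists_rangeRestrict_sub_C_mem rangeRestrict_X_mem_segrePrime_zero f)
  rw [← map_sub, sub_sub_cancel, rangeRestrict_mem_segrePrime] at h0
  have hc : MvPolynomial.constantCoeff f = 0 := by
    rw [MvPolynomial.algHom_C, AlgHom.commutes] at h0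
    exact MvPolynomial.C_injective _ _ (h0.trans (map_zero _).symm)
  simpa [hc] using exists_rangeRestrict_sub_C_mem hP f

/-- Nullstellensatz on the Segre cone: if the linear forms `∑ c s i j * z i j` have no common zero
among the nonzero matrices of rank one, then the only prime ideal containing them all and contained
in the ideal of the vertex is the latter. -/
theorem segrePrime_zero_le_of_isPrime [IsAlgClosed K] {ι : Type*} (c : ι → Fin a → Fin b → K)
    (hc : ∀ (x : Fin a → K) (u : Fin b → K), (∀ s, ∑ i, ∑ j, x i * u j * c s i j = 0) →
      ∀ i j, x i * u j = 0)
    {P : Ideal (SegreRing K a b)} [P.IsPrime]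
    (hP : ∀ s, (segreMap K a b).rangeRestrict
      (∑ i, ∑ j, MvPolynomial.X (i, j) * MvPolynomial.C (c s i j)) ∈ P) :
    segrePrime K a b 0 ≤ P := by
  refine segrePrime_zero_le fun q => ?_
  set Q : Ideal (MvPolynomial (Fin a × Fin b) K) :=
    P.comap (segreMap K a b).rangeRestrict with hQ
  have : Q.IsPrime := Ideal.comap_isPrime _ _
  change MvPolynomial.X q ∈ Q
  rw [← MvPolynomial.IsPrime.vanishingIdeal_zeroLocus (K := K) Q]
  intro z hz
  rw [MvPolynomial.aeval_X]
  by_contra hne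
  have hminor : ∀ i j, z (i, j) * z q = z (i, q.2) * z (q.1, j) := by
    intro i j
    have hmem : (MvPolynomial.X (i, j) * MvPolynomial.X q -
        MvPolynomial.X (i, q.2) * MvPolynomial.X (q.1, j) : MvPolynomial _ K) ∈ Q := by
      have h0 : (segreMap K a b).rangeRestrict (MvPolynomial.X (i, j) * MvPolynomial.X q -
          MvPolynomial.X (i, q.2) * MvPolynomial.X (q.1, j)) = 0 := by
        apply Subtype.ext
        change segreMap K a b _ = 0
        simp only [segreMap, map_sub, map_mul, MvPolynomial.aeval_X]
        ring
      rw [hQ, Ideal.mem_comap, h0]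
      exact P.zero_mem
    have := hz _ hmem
    simpa [sub_eq_zero] using this
  -- `z` is the rank one matrix with entries `z (i, q.2) * (z (q.1, j) / z q)`
  have hz' : ∀ i j, z (i, q.2) * (z (q.1, j) / z q) = z (i, j) := by
    intro i j
    rw [← mul_div_assoc, ← hminor, mul_div_cancel_right₀ _ hne]
  have h1 := hc (fun i => z (i, q.2)) (fun j => z (q.1, j) / z q) (fun s => by
    have h2 := hz _ (hP s)
    simpa [hz'] using h2) q.1 q.2
  rw [hz'] at h1
  exact hne h1

/-- At least `a + b - 1` bilinear forms on `Kᵃ × Kᵇ` are needed in order that they have no common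
zero `(x, u)` with `x ≠ 0` and `u ≠ 0`: as linear forms on the Segre cone they cut out its vertex,
whose ideal has height at least `a + b - 1`, and Krull's height theorem applies. -/
theorem add_le_card_add_one_of_bilinearForms [IsAlgClosed K] {ι : Type*} [Fintype ι]
    (ha : 0 < a) (hb : 0 < b) (c : ι → Fin a → Fin b → K)
    (hc : ∀ (x : Fin a → K) (u : Fin b → K), (∀ s, ∑ i, ∑ j, x i * u j * c s i j = 0) →
      ∀ i j, x i * u j = 0) :
    a + b ≤ Fintype.card ι + 1 := by
  set l : ι → SegreRing K a b := fun s => (segreMap K a b).rangeRestrict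
      (∑ i, ∑ j, MvPolynomial.X (i, j) * MvPolynomial.C (c s i j)) with hl
  have hmin : segrePrime K a b 0 ∈ (Ideal.span (Set.range l)).minimalPrimes := by
    refine ⟨⟨inferInstance, ?_⟩, ?_⟩
    · rw [Ideal.span_le]
      rintro _ ⟨s, rfl⟩
      simp only [hl, map_sum, map_mul]
      exact sum_mem fun i _ => sum_mem fun j _ =>
        Ideal.mul_mem_right _ _ (rangeRestrict_X_mem_segrePrime_zero _)
    · rintro P ⟨hP, hle⟩ -
      exact segrePrime_zero_le_of_isPrime c hc fun s => hle (Ideal.subset_span ⟨s, rfl⟩)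
  have h1 := Ideal.height_le_card_of_mem_minimalPrimes_span (Set.finite_range l) hmin
  have h2 := le_height_segrePrime (K := K) ha hb (a + b - 1) 0 (by omega)
  have h3 : a + b - 1 ≤ (Set.range l).ncard := by exact_mod_cast h2.trans h1
  have h4 : (Set.range l).ncard ≤ Fintype.card ι := by
    rw [← Set.image_univ, ← Nat.card_eq_fintype_card, ← Set.ncard_univ]
    exact Set.ncard_image_le
  omega

/-- **Hopf's lemma** over an algebraically closed field: a bilinear map `V × U → X` which is
nondegenerate, in the sense that `B x u ≠ 0` for `x ≠ 0` and `u ≠ 0`, satisfies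
`dim X ≥ dim V + dim U - 1`. -/
theorem finrank_add_finrank_le_of_bilin_ne_zero {V U X : Type*} [IsAlgClosed K]
    [AddCommGroup V] [Module K V] [FiniteDimensional K V] [Nontrivial V]
    [AddCommGroup U] [Module K U] [FiniteDimensional K U] [Nontrivial U]
    [AddCommGroup X] [Module K X] [FiniteDimensional K X]
    (B : V →ₗ[K] U →ₗ[K] X) (hB : ∀ x u, B x u = 0 → x = 0 ∨ u = 0) :
    Module.finrank K V + Module.finrank K U ≤ Module.finrank K X + 1 := by
  let e := Module.finBasis K V
  let f := Module.finBasis K U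
  let g := Module.finBasis K X
  have := add_le_card_add_one_of_bilinearForms (Module.finrank_pos (R := K) (M := V))
    (Module.finrank_pos (R := K) (M := U)) (fun s i j => g.repr (B (e i) (f j)) s) ?_
  · simpa using this
  intro x u h i j
  have h0 : B (∑ i, x i • e i) (∑ j, u j • f j) = 0 := by
    rw [← g.repr.map_eq_zero_iff]
    ext s
    rw [Finsupp.zero_apply, ← h s]
    simp only [map_sum, map_smul, LinearMap.sum_apply, LinearMap.smul_apply, Finset.smul_sum,
      Finsupp.finsetSum_apply, Finsupp.smul_apply, smul_eq_mul, mul_assoc]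
    rw [Finset.sum_comm]
    exact Finset.sum_congr rfl fun _ _ => Finset.sum_congr rfl fun _ _ => mul_left_comm _ _ _
  rcases hB _ _ h0 with h1 | h1
  · rw [Fintype.linearIndependent_iff.1 e.linearIndependent x h1 i, zero_mul]
  · rw [Fintype.linearIndependent_iff.1 f.linearIndependent u h1 j, mul_zero]

end Segre

/-! ### Regular functions and sections on a hyperplane -/

section RegularFunctions

variable {n : ℕ} {Z : Set (ProjSp n)}

theorem MvPolynomial.IsHomogeneous.eval_smul_eq {σ R : Type*} [CommSemiring R] {d : ℕ}
    {F : MvPolynomial σ R} (hF : F.IsHomogeneous d) (c : R) (v : σ → R) :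
    MvPolynomial.eval (c • v) F = c ^ d * MvPolynomial.eval v F := by
  rw [MvPolynomial.eval_eq, MvPolynomial.eval_eq, Finset.mul_sum]
  refine Finset.sum_congr rfl fun m hm => ?_
  have hd : ∑ i ∈ m.support, m i = d := by
    have := hF (MvPolynomial.mem_support_iff.1 hm)
    rw [Finsupp.weight_apply] at this
    simpa [Finsupp.sum] using this
  simp only [Pi.smul_apply, smul_eq_mul, mul_pow, Finset.prod_mul_distrib,
    Finset.prod_pow_eq_pow_sum, hd]
  ring

/-- Local form of a regular function in terms of arbitrary representatives of the points. -/
theorem IsRegularFun.exists_eq_div {f : Z → ℂ} (hf : IsRegularFun Z f)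
    {v : Fin (n + 1) → ℂ} (hv : v ≠ 0) (hvZ : Projectivization.mk ℂ v hv ∈ Z) :
    ∃ F G : MvPolynomial (Fin (n + 1)) ℂ, MvPolynomial.eval v G ≠ 0 ∧
      ∀ (u : Fin (n + 1) → ℂ) (hu : u ≠ 0) (huZ : Projectivization.mk ℂ u hu ∈ Z),
        MvPolynomial.eval u G ≠ 0 →
          f ⟨Projectivization.mk ℂ u hu, huZ⟩ = MvPolynomial.eval u F / MvPolynomial.eval u G := by
  obtain ⟨d, F, G, hF, hG, h0, h⟩ := hf ⟨Projectivization.mk ℂ v hv, hvZ⟩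
  refine ⟨F, G, ?_, fun u hu huZ hne => ?_⟩
  · obtain ⟨c, hc⟩ := Projectivization.exists_smul_eq_mk_rep ℂ v hv
    change MvPolynomial.eval (Projectivization.mk ℂ v hv).rep G ≠ 0 at h0
    rw [← hc, Units.smul_def, hG.eval_smul_eq] at h0
    exact right_ne_zero_of_mul h0
  · obtain ⟨c, hc⟩ := Projectivization.exists_smul_eq_mk_rep ℂ u hu
    have hcd : (c : ℂ) ^ d ≠ 0 := pow_ne_zero _ c.ne_zero
    have := h ⟨Projectivization.mk ℂ u hu, huZ⟩
    simp only [← hc, Units.smul_def, hG.eval_smul_eq, hF.eval_smul_eq] at this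
    rw [this (mul_ne_zero hcd hne), mul_div_mul_left _ _ hcd]

theorem differentiable_eval_add_smul (F : MvPolynomial (Fin (n + 1)) ℂ)
    (x y : Fin (n + 1) → ℂ) :
    Differentiable ℂ fun t : ℂ => MvPolynomial.eval (x + t • y) F := by
  induction F using MvPolynomial.induction_on with
  | C c => simp
  | add F G hF hG =>
    simp only [map_add]
    exact hF.add hG
  | mul_X F i hF =>
    simp only [map_mul, MvPolynomial.eval_X, Pi.add_apply, Pi.smul_apply, smul_eq_mul]
    exact hF.mul (by fun_prop)

/-- A regular function takes the same value at two points joined by a line contained in its domain: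
along the line it is an entire function with a finite limit at infinity, so that Liouville's theorem
applies. -/
theorem IsRegularFun.eq_of_line {f : Z → ℂ} (hf : IsRegularFun Z f)
    {x y : Fin (n + 1) → ℂ} (hx : x ≠ 0) (hy : y ≠ 0)
    (hxZ : Projectivization.mk ℂ x hx ∈ Z) (hyZ : Projectivization.mk ℂ y hy ∈ Z)
    (hxy : ∀ s t : ℂ, s ≠ 0 ∨ t ≠ 0 → ∃ h : s • x + t • y ≠ 0, Projectivization.mk ℂ _ h ∈ Z) :
    f ⟨_, hxZ⟩ = f ⟨_, hyZ⟩ := by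
  have h1 : ∀ t : ℂ, ∃ h : x + t • y ≠ 0, Projectivization.mk ℂ _ h ∈ Z := fun t => by
    simpa using hxy 1 t (by simp)
  have h2 : ∀ t : ℂ, ∃ h : y + t • x ≠ 0, Projectivization.mk ℂ _ h ∈ Z := fun t => by
    simpa [add_comm] using hxy t 1 (by simp)
  set g : ℂ → ℂ := fun t => f ⟨_, (h1 t).choose_spec⟩ with hg
  have hdiff : Differentiable ℂ g := by
    intro t
    obtain ⟨F, G, hG, hFG⟩ := hf.exists_eq_div (h1 t).choose (h1 t).choose_spec
    have hdF := differentiable_eval_add_smul F x y t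
    have hdG := differentiable_eval_add_smul G x y t
    refine (hdF.div hdG hG).congr_of_eventuallyEq ?_
    filter_upwards [hdG.continuousAt.eventually_ne hG] with s hs
    exact hFG _ _ _ hs
  have hlim : Filter.Tendsto g (Filter.cocompact ℂ) (nhds (f ⟨_, hyZ⟩)) := by
    obtain ⟨F, G, hG, hFG⟩ := hf.exists_eq_div hy hyZ
    have hcF := (differentiable_eval_add_smul F y x 0).continuousAt
    have hcG := (differentiable_eval_add_smul G y x 0).continuousAt
    have hG' : MvPolynomial.eval (y + (0 : ℂ) • x) G ≠ 0 := by simpa using hG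
    have hlim0 : Filter.Tendsto (fun t : ℂ => MvPolynomial.eval (y + t⁻¹ • x) F /
        MvPolynomial.eval (y + t⁻¹ • x) G) (Filter.cocompact ℂ) (nhds (f ⟨_, hyZ⟩)) := by
      have := (hcF.div hcG hG').tendsto.comp (Filter.tendsto_inv₀_cobounded (α := ℂ))
      rw [Metric.cobounded_eq_cocompact] at this
      simpa [Function.comp_def, hFG y hy hyZ hG] using this
    refine hlim0.congr' ?_
    have hev : ∀ᶠ t : ℂ in Filter.cocompact ℂ, MvPolynomial.eval (y + t⁻¹ • x) G ≠ 0 := by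
      have := (Filter.tendsto_inv₀_cobounded (α := ℂ)).eventually (hcG.eventually_ne hG')
      rwa [Metric.cobounded_eq_cocompact] at this
    have hne : ∀ᶠ t : ℂ in Filter.cocompact ℂ, t ≠ 0 := by
      exact (isCompact_singleton (x := (0 : ℂ))).compl_mem_cocompact
    filter_upwards [hev, hne] with t ht ht0
    rw [← hFG _ (h2 t⁻¹).choose (h2 t⁻¹).choose_spec ht]
    congr 2
    rw [Projectivization.mk_eq_mk_iff']
    exact ⟨t⁻¹, by rw [smul_add, smul_smul, inv_mul_cancel₀ ht0, one_smul, add_comm y]⟩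
  have := hdiff.apply_eq_of_tendsto_cocompact 0 hlim
  rw [← this, hg]
  congr 2
  simp

theorem Hyperplane.mk_mem_points_iff (H : Hyperplane n) {v : Fin (n + 1) → ℂ} (hv : v ≠ 0) :
    Projectivization.mk ℂ v hv ∈ H.points ↔ H.rep v = 0 := by
  constructor
  · intro h
    refine h _ ?_ v ?_
    · rw [H.submodule_eq]
      exact Submodule.mem_span_singleton_self _
    · rw [Projectivization.submodule_mk]
      exact Submodule.mem_span_singleton_self _
  · intro h ξ hξ x hx
    rw [H.submodule_eq, Submodule.mem_span_singleton] at hξ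
    rw [Projectivization.submodule_mk, Submodule.mem_span_singleton] at hx
    obtain ⟨c, rfl⟩ := hξ
    obtain ⟨d, rfl⟩ := hx
    simp [h]

/-- Regular functions on a hyperplane are constant. -/
theorem IsRegularFun.eq_of_hyperplane {H : Hyperplane n} {f : H.points → ℂ}
    (hf : IsRegularFun H.points f) (p q : H.points) : f p = f q := by
  obtain ⟨p, hp⟩ := p
  obtain ⟨q, hq⟩ := q
  induction p using Projectivization.ind with | h x hx
  induction q using Projectivization.ind with | h y hy
  by_cases hxy : Projectivization.mk ℂ x hx = Projectivization.mk ℂ y hy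
  · congr 2
  · refine hf.eq_of_line hx hy hp hq fun s t hst => ?_
    rw [H.mk_mem_points_iff] at hp hq
    have hne : s • x + t • y ≠ 0 := by
      intro h0
      by_cases hs : s = 0
      · have ht : t ≠ 0 := hst.resolve_left (not_not.2 hs)
        rw [hs, zero_smul, zero_add] at h0
        exact (smul_ne_zero ht hy) h0
      · refine hxy ((Projectivization.mk_eq_mk_iff' ..).2 ⟨-(s⁻¹ * t), ?_⟩)
        rw [neg_smul, mul_smul, ← smul_neg, ← eq_neg_of_add_eq_zero_left h0, smul_smul,
          inv_mul_cancel₀ hs, one_smul]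
    exact ⟨hne, (H.mk_mem_points_iff hne).2 (by simp [hp, hq])⟩

end RegularFunctions

namespace SteinerBundle

variable {n k : ℕ} {W I : Type*} [AddCommGroup W] [Module ℂ W] [FiniteDimensional ℂ W]
  [AddCommGroup I] [Module ℂ I] [FiniteDimensional ℂ I]

/-- An unstable hyperplane `ξ = 0` carries a nonzero constant section `w` of `S*`; in other words,
`A` sends `w` to a decomposable tensor `ξ ⊗ i`. -/
theorem IsUnstable.exists_eq_smul {S : SteinerBundle n k W I} {H : Hyperplane n}
    (h : S.IsUnstable H) : ∃ (w : W) (i : I), w ≠ 0 ∧ ∀ x, S.A x w = H.rep x • i := by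
  have hnt : Nontrivial (S.dualSections H.points) := by
    by_contra hn
    rw [not_nontrivial_iff_subsingleton] at hn
    exact h (rank_subsingleton' _ _)
  obtain ⟨⟨s, hs⟩, hs0⟩ := exists_ne (0 : S.dualSections H.points)
  obtain ⟨p, hp⟩ : ∃ p, s p ≠ 0 := by
    by_contra! hall
    exact hs0 (Subtype.ext (funext hall))
  have hconst : ∀ q, s q = s p := by
    intro q
    rw [← sub_eq_zero, ← Module.forall_dual_apply_eq_zero_iff ℂ]
    intro φ
    rw [map_sub, sub_eq_zero]
    exact (hs.1 φ).eq_of_hyperplane q p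
  have hker : ∀ x, H.rep x = 0 → S.A x (s p) = 0 := by
    intro x hx
    by_cases hx0 : x = 0
    · simp [hx0]
    · have hmem := (H.mk_mem_points_iff hx0).2 hx
      rw [← hconst ⟨_, hmem⟩]
      refine hs.2 ⟨_, hmem⟩ x ?_
      rw [Projectivization.submodule_mk]
      exact Submodule.mem_span_singleton_self x
  obtain ⟨y, hy⟩ : ∃ y, H.rep y ≠ 0 := by
    by_contra! hall
    exact H.rep_nonzero (LinearMap.ext hall)
  refine ⟨s p, (H.rep y)⁻¹ • S.A y (s p), hp, fun x => ?_⟩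
  have h1 := hker (x - (H.rep x * (H.rep y)⁻¹) • y) (by simp [hy])
  rw [map_sub, map_smul, LinearMap.sub_apply, LinearMap.smul_apply, sub_eq_zero] at h1
  rw [h1, smul_smul]

end SteinerBundle

/-! ### Linear algebra of Steiner bundles -/

namespace SteinerBundle

variable {n k : ℕ} {W I : Type*} [AddCommGroup W] [Module ℂ W] [FiniteDimensional ℂ W]
  [AddCommGroup I] [Module ℂ I] [FiniteDimensional ℂ I]

/-- Since `W` has the least dimension allowed by Hopf's lemma, the tensor of a Steiner bundle cannot
send too large a block `V₀ ⊗ W₀` into a proper subspace `I₀` of `I`: apply Hopf's lemma to the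
pairing of `V₀` with the linear forms on `I / I₀`, whose values are linear forms on `W / W₀`. -/
theorem finrank_add_finrank_le (S : SteinerBundle n k W I)
    {V₀ : Submodule ℂ (Fin (n + 1) → ℂ)} {W₀ : Submodule ℂ W} {I₀ : Submodule ℂ I}
    (hV : V₀ ≠ ⊥) (hI : I₀ ≠ ⊤) (h : ∀ x ∈ V₀, ∀ w ∈ W₀, S.A x w ∈ I₀) :
    Module.finrank ℂ W₀ + Module.finrank ℂ V₀ ≤ n + 1 + Module.finrank ℂ I₀ := by
  have : Nontrivial V₀ := Submodule.nontrivial_iff_ne_bot.2 hV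
  have hIr := Subspace.finrank_add_finrank_dualAnnihilator_eq I₀
  have hWr := Subspace.finrank_add_finrank_dualAnnihilator_eq W₀
  rw [S.finrank_I] at hIr
  rw [S.finrank_W] at hWr
  have : Nontrivial I₀.dualAnnihilator := by
    apply Module.nontrivial_of_finrank_pos (R := ℂ)
    have := Submodule.finrank_lt hI
    rw [S.finrank_I] at this
    omega
  let B : V₀ →ₗ[ℂ] I₀.dualAnnihilator →ₗ[ℂ] W₀.dualAnnihilator :=
    LinearMap.mk₂ ℂ (fun x φ => ⟨(φ : Module.Dual ℂ I) ∘ₗ S.A x, by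
        rw [Submodule.mem_dualAnnihilator]
        exact fun w hw => (Submodule.mem_dualAnnihilator _).1 φ.2 _ (h _ x.2 w hw)⟩)
      (fun x y φ => by ext; simp) (fun c x φ => by ext; simp)
      (fun x φ ψ => by ext; simp) (fun c x φ => by ext; simp)
  have hB : ∀ x φ, B x φ = 0 → x = 0 ∨ φ = 0 := by
    intro x φ h0
    by_contra! hne
    refine hne.2 (Subtype.ext (LinearMap.ext fun i => ?_))
    obtain ⟨w, rfl⟩ := S.surjective x (fun hx => hne.1 (Subtype.ext hx)) i
    exact LinearMap.congr_fun (congrArg Subtype.val h0) w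
  have := finrank_add_finrank_le_of_bilin_ne_zero B hB
  omega

theorem card_add_finrank_le (S : SteinerBundle n k W I) {ι : Type*} [Fintype ι] {w : ι → W}
    (hw : LinearIndependent ℂ w) {V₀ : Submodule ℂ (Fin (n + 1) → ℂ)} {I₀ : Submodule ℂ I}
    (hV : V₀ ≠ ⊥) (hI : Module.finrank ℂ I₀ < k) (h : ∀ x ∈ V₀, ∀ j, S.A x (w j) ∈ I₀) :
    Fintype.card ι + Module.finrank ℂ V₀ ≤ n + 1 + Module.finrank ℂ I₀ := by
  rw [← finrank_span_eq_card hw]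
  refine S.finrank_add_finrank_le hV ?_ fun x hx v hv => ?_
  · rintro rfl
    rw [finrank_top, S.finrank_I] at hI
    exact hI.false
  · have hle : Submodule.span ℂ (Set.range w) ≤ I₀.comap (S.A x) := by
      rw [Submodule.span_le]
      rintro _ ⟨j, rfl⟩
      exact h x hx j
    exact hle hv

/-- `S*` has no nonzero global section. -/
theorem eq_zero_of_forall_A_eq_zero (S : SteinerBundle n k W I) (hk : 0 < k) {w : W}
    (hw : ∀ x, S.A x w = 0) : w = 0 := by
  by_contra hne
  have hli : LinearIndependent ℂ (fun _ : Unit => w) := linearIndependent_unique_iff.2 hne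
  have := S.card_add_finrank_le hli (V₀ := ⊤) (I₀ := ⊥) top_ne_bot (by simpa using hk)
    (fun x _ _ => by simp [hw])
  simp at this

/-- Linearly independent elements of `W` cannot be sent to decomposable tensors `ξ ⊗ i` and
`ξ' ⊗ i` with the same factor in `I`. This fails for `k = 1`. -/
theorem not_linearIndependent_pair (S : SteinerBundle n k W I) (hk : 2 ≤ k) {w w' : W} {i : I}
    {ξ ξ' : Module.Dual ℂ (Fin (n + 1) → ℂ)}
    (hw : ∀ x, S.A x w = ξ x • i) (hw' : ∀ x, S.A x w' = ξ' x • i) :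
    ¬ LinearIndependent ℂ ![w, w'] := by
  intro hli
  have hle : Module.finrank ℂ (ℂ ∙ i) ≤ 1 := by
    simpa using finrank_span_le_card (R := ℂ) ({i} : Set I)
  have := S.card_add_finrank_le hli (V₀ := ⊤) (I₀ := ℂ ∙ i) top_ne_bot (by omega) (fun x _ j => by
    refine Submodule.mem_span_singleton.2 ?_
    fin_cases j
    · exact ⟨ξ x, (hw x).symm⟩
    · exact ⟨ξ' x, (hw' x).symm⟩)
  simp at this
  omega

/-- If the hyperplanes `ξ j = 0` have a common point, then elements `w l` of `W` such that `A x (w l)`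
vanishes at all common points `[x]` of these hyperplanes are linearly dependent as soon as there are
more of them than hyperplanes. -/
theorem not_linearIndependent_of_card_lt (S : SteinerBundle n k W I) (hk : 0 < k)
    {ι κ : Type*} [Fintype ι] [Fintype κ] (hcard : Fintype.card κ < Fintype.card ι)
    {ξ : κ → Module.Dual ℂ (Fin (n + 1) → ℂ)} {w : ι → W} {y : Fin (n + 1) → ℂ} (hy : y ≠ 0)
    (hξ : ∀ j, ξ j y = 0) (hw : ∀ x, (∀ j, ξ j x = 0) → ∀ l, S.A x (w l) = 0) :
    ¬ LinearIndependent ℂ w := by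
  intro hli
  let F : (Fin (n + 1) → ℂ) →ₗ[ℂ] (κ → ℂ) := LinearMap.pi ξ
  have hF : n + 1 ≤ Fintype.card κ + Module.finrank ℂ (LinearMap.ker F) := by
    have h1 := F.finrank_range_add_finrank_ker
    have h2 := (LinearMap.range F).finrank_le
    simp only [Module.finrank_fintype_fun_eq_card, Fintype.card_fin] at h1 h2
    omega
  have hker : LinearMap.ker F ≠ ⊥ := fun h0 =>
    hy ((Submodule.eq_bot_iff _).1 h0 y (LinearMap.mem_ker.2 (funext hξ)))
  have := S.card_add_finrank_le hli (I₀ := ⊥) hker (by simpa using hk) (fun x hx l => by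
    rw [Submodule.mem_bot]
    exact hw x (fun j => congrFun (LinearMap.mem_ker.1 hx) j) l)
  rw [finrank_bot] at this
  omega

/-- Normal crossing in terms of linear forms: let nonzero elements `w j` of `W` be sent to
decomposable tensors `ξ j ⊗ i j`. If the forms `ξ j` are pairwise linearly independent and have a
common zero `y ≠ 0`, then they are linearly independent. -/
theorem linearIndependent_of_forall_A_eq_smul (S : SteinerBundle n k W I) (hk : 2 ≤ k) {ι : Type*}
    {ξ : ι → Module.Dual ℂ (Fin (n + 1) → ℂ)} {w : ι → W} {i : ι → I}
    (hw0 : ∀ j, w j ≠ 0)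
    (hw : ∀ j x, S.A x (w j) = ξ j x • i j)
    (hξ : ∀ j, ξ j ≠ 0) (hξ2 : ∀ j l, j ≠ l → LinearIndependent ℂ ![ξ j, ξ l])
    {y : Fin (n + 1) → ℂ} (hy : y ≠ 0) (hξy : ∀ j, ξ j y = 0) :
    LinearIndependent ℂ ξ := by
  classical
  have hi : ∀ j, i j ≠ 0 := fun j h0 =>
    hw0 j (S.eq_zero_of_forall_A_eq_zero (by omega) fun x => by rw [hw, h0, smul_zero])
  have key : ∀ T : Finset ι, LinearIndepOn ℂ ξ (T : Set ι) := by
    intro T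
    induction T using Finset.induction_on with
    | empty => simp
    | insert m T hm ih =>
      rw [Finset.coe_insert, linearIndepOn_insert (by simpa using hm)]
      refine ⟨ih, fun hmem => ?_⟩
      obtain ⟨c, hc⟩ := (Submodule.mem_span_image_finset_iff_exists_fun' ℂ).1 hmem
      have hcx : ∀ x, ξ m x = ∑ j ∈ T, c j * ξ j x := fun x => by
        rw [← hc]; simp
      -- there are `#T + 1` elements `w j`, and they vanish where the `#T` forms `ξ j` do
      have hdep : ¬ LinearIndepOn ℂ w (insert m T : Finset ι) := by
        refine S.not_linearIndependent_of_card_lt (κ := T) (by omega) ?_ (ξ := fun j => ξ j) hy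
          (fun j => hξy j) ?_
        · simp [hm]
        · rintro x hx ⟨l, hl⟩
          rw [hw]
          rcases Finset.mem_insert.1 hl with rfl | hl
          · rw [hcx, Finset.sum_eq_zero fun j hj => by rw [hx ⟨j, hj⟩, mul_zero], zero_smul]
          · rw [hx ⟨l, hl⟩, zero_smul]
      rw [linearIndepOn_finset_iff] at hdep
      push Not at hdep
      obtain ⟨b, hb, hb0⟩ := hdep
      rw [Finset.sum_insert hm] at hb
      -- substitute `ξ m = ∑ c j • ξ j` into the relation `∑ b j • ξ j ⊗ i j = 0`
      have hrel : ∀ j ∈ T, b j • i j + (b m * c j) • i m = 0 := by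
        intro j hj
        rw [← Module.forall_dual_apply_eq_zero_iff ℂ]
        intro φ
        refine linearIndepOn_finset_iff.1 ih
          (fun j => φ (b j • i j + (b m * c j) • i m)) ?_ j hj
        refine LinearMap.ext fun x => ?_
        have h1 := congrArg (fun v => φ (S.A x v)) hb
        simp only [map_add, map_sum, map_smul, hw, hcx, map_zero, smul_eq_mul] at h1
        rw [LinearMap.sum_apply, LinearMap.zero_apply, ← h1, Finset.sum_mul, Finset.mul_sum,
          ← Finset.sum_add_distrib]
        refine Finset.sum_congr rfl fun l _ => ?_
        simp only [map_add, map_smul, LinearMap.smul_apply, smul_eq_mul]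
        ring
      have hbm : b m ≠ 0 := by
        intro h0
        obtain ⟨l, hl, hbl⟩ := hb0
        rcases Finset.mem_insert.1 hl with rfl | hl
        · exact hbl h0
        · have := hrel l hl
          rw [h0, zero_mul, zero_smul, add_zero] at this
          exact (smul_ne_zero hbl (hi l)) this
      obtain ⟨j, hj, hcj⟩ : ∃ j ∈ T, c j ≠ 0 := by
        by_contra! hall
        exact hξ m (LinearMap.ext fun x => by
          rw [hcx, Finset.sum_eq_zero fun j hj => by rw [hall j hj, zero_mul]]; rfl)
      have hbc : b m * c j ≠ 0 := mul_ne_zero hbm hcj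
      have him : i m = (-(b m * c j)⁻¹ * b j) • i j := by
        rw [mul_smul, eq_neg_of_add_eq_zero_left (hrel j hj), smul_neg, neg_smul, neg_neg,
          smul_smul, inv_mul_cancel₀ hbc, one_smul]
      set r : ℂ := -(b m * c j)⁻¹ * b j with hr
      have hr0 : r ≠ 0 := fun h0 => hi m (by rw [him, h0, zero_smul])
      refine S.not_linearIndependent_pair hk (hw j) (ξ' := r • ξ m) (w' := w m) (fun x => by
        rw [hw, him, smul_smul, LinearMap.smul_apply, smul_eq_mul, mul_comm]) ?_
      have hjm : j ≠ m := fun h => hm (h ▸ hj)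
      rw [LinearIndependent.pair_iff]
      intro s t hst
      have h2 : s • ξ j + (t * r) • ξ m = 0 := by
        refine LinearMap.ext fun x => ?_
        have h3 := congrArg (S.A x) hst
        rw [map_add, map_smul, map_smul, hw, hw, him, map_zero, smul_smul, smul_smul, smul_smul,
          ← add_smul] at h3
        have h4 := (smul_eq_zero.1 h3).resolve_right (hi j)
        simp only [LinearMap.add_apply, LinearMap.smul_apply, smul_eq_mul, LinearMap.zero_apply]
        linear_combination h4
      have h5 := LinearIndependent.pair_iff.1 (hξ2 j m hjm) _ _ h2
      exact ⟨h5.1, (mul_eq_zero.1 h5.2).resolve_right hr0⟩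
  rw [linearIndependent_iff']
  intro T g hg j hj
  exact linearIndepOn_finset_iff.1 (key T) g hg j hj

end SteinerBundle

theorem theorem3p10 {n k : ℕ} (hk : 2 ≤ k) {W I : Type*}
    [AddCommGroup W] [Module ℂ W] [FiniteDimensional ℂ W]
    [AddCommGroup I] [Module ℂ I] [FiniteDimensional ℂ I]
    (S : SteinerBundle n k W I) (𝓗 : Set (Hyperplane n)) (h𝓗 : 𝓗 ⊆ S.unstableHyperplanes) :
    HasNormalCrossing 𝓗 := by
  intro p
  rw [Projectivization.independent_iff]
  have hex : ∀ H : {H : Hyperplane n // H ∈ 𝓗 ∧ p ∈ H.points}, ∃ (w : W) (i : I), w ≠ 0 ∧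
      ∀ x, S.A x w = H.1.rep x • i := fun H =>
    SteinerBundle.IsUnstable.exists_eq_smul (h𝓗 H.2.1)
  choose w i hw0 hw using hex
  refine S.linearIndependent_of_forall_A_eq_smul hk hw0 hw (fun H => H.1.rep_nonzero) ?_
    p.rep_nonzero fun H => ?_
  · intro H H' hne
    have h1 := Projectivization.linearIndependent_pair_iff_ne.2 (Subtype.coe_injective.ne hne)
    simpa using h1
  · have h1 : Projectivization.mk ℂ p.rep p.rep_nonzero ∈ H.1.points := by
      rw [Projectivization.mk_rep]
      exact H.2.2
    exact (H.1.mk_mem_points_iff _).1 h1
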